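/- A graph $\Gamma$ here consists of a set $V_\Gamma$ of vertices, a set $E_\Gamma$ of edges, maps $s,t\colon E_\Gamma\to V_\Gamma$ (source and target) and a weight $w\colon E_\Gamma\to\mathbb{Z}_{>0}$; loops and multiple edges are allowed. A walk from $x$ to $y$ is a sequence of edges $e_1\cdots e_\ell$ with $s(e_1)=x$, $t(e_\ell)=y$ and $t(e_j)=s(e_{j+1})$ for $1\le j<\ell$, or the trivial walk of length $0$ if $x=y$; its weight is $\sum_j w(e_j)$. Let $d_\Gamma(x,y)\in\mathbb{Z}_{\ge 0}\cup\{\infty\}$ be the smallest weight of a walk from $x$ to $y$, and $\infty$ if there is none. Let $n\ge 1$. An $n$-dimensional periodic graph $(\Gamma,L)$ is a graph $\Gamma$ together with a free abelian group $L\simeq\mathbb{Z}^n$ that acts freely on both $V_\Gamma$ and $E_\Gamma$, with finite quotients $V_\Gamma/L$ and $E_\Gamma/L$, such that $s(u+e)=u+s(e)$, $t(u+e)=u+t(e)$ and $w(u+e)=w(e)$ for all $u\in L$ and $e\in E_\Gamma$. A function $f\colon\mathbb{Z}\to\mathbb{C}$ is a quasi-polynomial if there are an integer $N\ge 1$ and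 polynomials $Q_0,\dots,Q_{N-1}\in\mathbb{C}[x]$ such that $f(m)=Q_j(m)$ whenever $m\equiv j \pmod N$. A function $g\colon\mathbb{Z}_{\ge 0}\to\mathbb{C}$ is of quasi-polynomial type if there are an integer $M\ge 0$ and a quasi-polynomial $f$ with $g(m)=f(m)$ for all $m>M$. **Theorem.** Let $(\Gamma,L)$ be an $n$-dimensional periodic graph, and let $U\subset V_\Gamma$ be a finite subset. Then for every $i\in\mathbb{Z}_{\ge 0}$ the set $\{y\in V_\Gamma \mid \min_{x\in U} d_\Gamma(x,y)\le i\}$ is finite, and the function $$\mathbb{Z}_{\ge 0}\to\mathbb{Z}_{\ge 0};\quad i\mapsto \#\Bigl\{y\in V_\Gamma \Bigm| \min_{x\in U} d_\Gamma(x,y)\le i\Bigr\}$$ is of quasi-polynomial type. (The minimum over the empty set is $\infty$.) -/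

import Mathlib

/-- A directed weighted graph with vertex set `V` and edge set `E`, possibly with loops and
multiple edges; the weights of the edges are positive integers. -/
structure WeightedDigraph (V E : Type*) where
  /-- the source of an edge -/
  src : E → V
  /-- the target of an edge -/
  tgt : E → V
  /-- the weight of an edge -/
  weight : E → ℕ
  weight_pos : ∀ e, 0 < weight e

namespace WeightedDigraph

variable {V E : Type*}

/-- `Γ.IsWalk x y p` says that the sequence of edges `p` is a walk from `x` to `y` in `Γ`.
The empty sequence is the trivial walk from `x` to `x`. -/
def IsWalk (Γ : WeightedDigraph V E) (x y : V) : List E → Prop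
  | [] => x = y
  | e :: p => Γ.src e = x ∧ Γ.IsWalk (Γ.tgt e) y p

/-- The weight of a sequence of edges: the sum of the weights of its members. -/
def walkWeight (Γ : WeightedDigraph V E) (p : List E) : ℕ :=
  (p.map Γ.weight).sum

/-- `Γ.dist x y` is the smallest weight of a walk from `x` to `y`; it is `⊤` if there is no
such walk. -/
noncomputable def dist (Γ : WeightedDigraph V E) (x y : V) : ℕ∞ :=
  ⨅ (p : List E) (_ : Γ.IsWalk x y p), (Γ.walkWeight p : ℕ∞)

/-- `(Γ, L)` is an `n`-dimensional periodic graph, for the given actions of the additive group `L`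
on the vertices and on the edges of `Γ`. -/
structure IsPeriodic (Γ : WeightedDigraph V E) (L : Type*) [AddCommGroup L]
    [AddAction L V] [AddAction L E] (n : ℕ) : Prop where
  dim_pos : 0 < n
  lattice : Nonempty (L ≃+ (Fin n → ℤ))
  free_vertices : ∀ (u : L) (x : V), u +ᵥ x = x → u = 0
  free_edges : ∀ (u : L) (e : E), u +ᵥ e = e → u = 0
  finite_vertices : Finite (AddAction.orbitRel.Quotient L V)
  finite_edges : Finite (AddAction.orbitRel.Quotient L E)
  src_vadd : ∀ (u : L) (e : E), Γ.src (u +ᵥ e) = u +ᵥ Γ.src e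
  tgt_vadd : ∀ (u : L) (e : E), Γ.tgt (u +ᵥ e) = u +ᵥ Γ.tgt e
  weight_vadd : ∀ (u : L) (e : E), Γ.weight (u +ᵥ e) = Γ.weight e

/-- The vertices `y` with `min_{x ∈ U} d(x, y) ≤ i`. The minimum over the empty set is `⊤`. -/
def ballAround (Γ : WeightedDigraph V E) (U : Finset V) (i : ℕ) : Set V :=
  {y | (⨅ x ∈ U, Γ.dist x y) ≤ (i : ℕ∞)}

end WeightedDigraph

/-- A function `f : ℤ → ℂ` is a quasi-polynomial if it agrees with a polynomial on each residue
class modulo some positive integer `N`. -/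
def IsQuasiPolynomial (f : ℤ → ℂ) : Prop :=
  ∃ (N : ℕ) (_ : 0 < N) (Q : Fin N → Polynomial ℂ),
    ∀ (n : ℤ) (i : Fin N), n ≡ ((i : ℕ) : ℤ) [ZMOD (N : ℤ)] → f n = (Q i).eval (n : ℂ)

/-- A function on the non-negative integers is of quasi-polynomial type if it agrees with a
quasi-polynomial at all sufficiently large integers. -/
def IsQuasiPolynomialType (g : ℕ → ℂ) : Prop :=
  ∃ (M : ℕ) (f : ℤ → ℂ), IsQuasiPolynomial f ∧ ∀ n : ℕ, M < n → g n = f (n : ℤ)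

/-! Record a walk by its displacement in `L` and its weight, an element of `L × ℕ`. There are
finitely many vertex orbits and finitely many edge labels between them, so Kleene's elimination of
vertices makes the set of walk labels between two orbits semilinear (`IsWalkLabel.isSemilinearSet`).
Adding multiples of `(0, 1)` relaxes "weight equal to `i`" to "weight at most `i`", so the balls,
restricted to one orbit and stacked over all radii, form a semilinear set as well
(`isSemilinearSet_ballAround`).

A semilinear set with finite slices has quasi-polynomial slice counts
(`IsSemilinearSet.hasQuasiPolynomialCount`). It is a finite union of translates of monoids generated
in positive degree. Inclusion-exclusion and a choice of lexicographically least coordinates reduce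
the count to upper sets of `ℕ^n`, and Dickson's lemma reduces these to orthants. Orthant counts are
killed by products of operators `E ^ d - 1`, up to finitely many terms, and Newton's formula turns
this into polynomials on residue classes. -/

/-! ### Sequences annihilated by powers of shift operators. -/

open Polynomial in
/-- A sequence is annihilated, up to finitely many terms, by a power of `E ^ N - 1` for some
positive `N`, where `E` is the shift operator. -/
def IsShiftQuasiPolynomial (f : ℕ → ℂ) : Prop :=
  ∃ m N k : ℕ, 0 < N ∧
    aeval (LinearMap.funLeft ℂ ℂ Nat.succ) (X ^ m * (X ^ N - 1) ^ k : ℂ[X]) f = 0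

namespace IsShiftQuasiPolynomial

open Polynomial

theorem aeval_eq_zero_of_dvd {p q : ℂ[X]} (h : p ∣ q) {f : ℕ → ℂ}
    (hp : aeval (LinearMap.funLeft ℂ ℂ Nat.succ) p f = 0) :
    aeval (LinearMap.funLeft ℂ ℂ Nat.succ) q f = 0 := by
  obtain ⟨r, rfl⟩ := h
  rw [mul_comm, map_mul, Module.End.mul_apply, hp, map_zero]

theorem aeval_X_pow_apply (m : ℕ) (f : ℕ → ℂ) (i : ℕ) :
    aeval (LinearMap.funLeft ℂ ℂ Nat.succ) (X ^ m : ℂ[X]) f i = f (i + m) := by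
  induction m generalizing i with
  | zero => simp
  | succ m ih =>
    rw [pow_succ', map_mul, Module.End.mul_apply, aeval_X, LinearMap.funLeft_apply, ih]
    congr 1
    omega

theorem aeval_X_pow_sub_one (N : ℕ) (f : ℕ → ℂ) :
    aeval (LinearMap.funLeft ℂ ℂ Nat.succ) (X ^ N - 1 : ℂ[X]) f = fwdDiff N f := by
  ext i
  rw [map_sub, LinearMap.sub_apply, Pi.sub_apply, aeval_X_pow_apply, map_one, Module.End.one_apply,
    fwdDiff]

theorem aeval_X_pow_sub_one_pow (N k : ℕ) (f : ℕ → ℂ) :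
    aeval (LinearMap.funLeft ℂ ℂ Nat.succ) ((X ^ N - 1) ^ k : ℂ[X]) f = (fwdDiff N)^[k] f := by
  induction k with
  | zero => simp
  | succ k ih =>
    rw [pow_succ', map_mul, Module.End.mul_apply, ih, aeval_X_pow_sub_one,
      Function.iterate_succ_apply']

/-- Any two annihilators of this shape divide a third one, so two sequences can be given a common
annihilator. -/
theorem annihilator_dvd {m m' N N' k k' : ℕ} (hm : m ≤ m') (hN : N ∣ N') (hk : k ≤ k') :
    (X ^ m * (X ^ N - 1) ^ k : ℂ[X]) ∣ X ^ m' * (X ^ N' - 1) ^ k' := by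
  obtain ⟨d, rfl⟩ := hN
  refine mul_dvd_mul (pow_dvd_pow _ hm) ((pow_dvd_pow _ hk).trans (pow_dvd_pow_of_dvd ?_ _))
  simpa [pow_mul] using sub_dvd_pow_sub_pow (X ^ N : ℂ[X]) 1 d

theorem add {f g : ℕ → ℂ} (hf : IsShiftQuasiPolynomial f) (hg : IsShiftQuasiPolynomial g) :
    IsShiftQuasiPolynomial (f + g) := by
  obtain ⟨m, N, k, hN, hf⟩ := hf
  obtain ⟨m', N', k', hN', hg⟩ := hg
  refine ⟨m + m', N * N', k + k', Nat.mul_pos hN hN', ?_⟩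
  rw [map_add, aeval_eq_zero_of_dvd (annihilator_dvd (by simp) (by simp) (by simp)) hf,
    aeval_eq_zero_of_dvd (annihilator_dvd (by simp) (by simp) (by simp)) hg, add_zero]

theorem neg {f : ℕ → ℂ} (hf : IsShiftQuasiPolynomial f) : IsShiftQuasiPolynomial (-f) := by
  obtain ⟨m, N, k, hN, hf⟩ := hf
  exact ⟨m, N, k, hN, by rw [map_neg, hf, neg_zero]⟩

theorem sub {f g : ℕ → ℂ} (hf : IsShiftQuasiPolynomial f) (hg : IsShiftQuasiPolynomial g) :
    IsShiftQuasiPolynomial (f - g) :=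
  sub_eq_add_neg f g ▸ hf.add hg.neg

theorem of_eventually_zero {f : ℕ → ℂ} (m : ℕ) (h : ∀ i, f (i + m) = 0) :
    IsShiftQuasiPolynomial f := by
  refine ⟨m, 1, 0, one_pos, ?_⟩
  ext i
  rw [pow_zero, mul_one, aeval_X_pow_apply, h, Pi.zero_apply]

theorem zero : IsShiftQuasiPolynomial 0 :=
  of_eventually_zero 0 fun _ => rfl

theorem of_shift {f : ℕ → ℂ} (d : ℕ) (h : IsShiftQuasiPolynomial fun i => f (i + d)) :
    IsShiftQuasiPolynomial f := by
  obtain ⟨m, N, k, hN, h⟩ := h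
  refine ⟨m + d, N, k, hN, ?_⟩
  rw [pow_add, mul_right_comm, map_mul, Module.End.mul_apply, ← h]
  congr 1
  ext i
  exact aeval_X_pow_apply d f i

theorem shift {f : ℕ → ℂ} (d : ℕ) (h : IsShiftQuasiPolynomial f) :
    IsShiftQuasiPolynomial fun i => f (i + d) := by
  obtain ⟨m, N, k, hN, h⟩ := h
  refine ⟨m, N, k, hN, ?_⟩
  have : (fun i => f (i + d)) = aeval (LinearMap.funLeft ℂ ℂ Nat.succ) (X ^ d : ℂ[X]) f := by
    ext i
    exact (aeval_X_pow_apply d f i).symm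
  rw [this, ← Module.End.mul_apply, ← map_mul, mul_comm, map_mul, Module.End.mul_apply, h, map_zero]

/-- A sequence is a shift quasi-polynomial if its differences with some step are. -/
theorem of_fwdDiff {f : ℕ → ℂ} {d : ℕ} (hd : 0 < d) (h : IsShiftQuasiPolynomial (fwdDiff d f)) :
    IsShiftQuasiPolynomial f := by
  obtain ⟨m, N, k, hN, h⟩ := h
  refine ⟨m, N * d, k + 1, Nat.mul_pos hN hd, ?_⟩
  rw [← aeval_X_pow_sub_one, ← Module.End.mul_apply, ← map_mul] at h
  refine aeval_eq_zero_of_dvd ?_ h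
  rw [pow_succ, ← mul_assoc]
  refine mul_dvd_mul (annihilator_dvd le_rfl (by simp) le_rfl) ?_
  simpa using annihilator_dvd (m := 0) (m' := 0) (k := 1) (k' := 1) le_rfl (dvd_mul_left d N) le_rfl

/-- Along a progression of step `N` that starts at or after `m`, the differences of order at least
`k` vanish, so Newton's forward formula is a polynomial in the number of steps. -/
theorem isQuasiPolynomialType {f : ℕ → ℂ} (hf : IsShiftQuasiPolynomial f) :
    IsQuasiPolynomialType f := by
  obtain ⟨m, N, k, hN, hf⟩ := hf
  have hΔ (j : ℕ) (hj : k ≤ j) (y : ℕ) (hy : m ≤ y) : (fwdDiff N)^[j] f y = 0 := by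
    have h := congrFun (aeval_eq_zero_of_dvd (annihilator_dvd le_rfl (dvd_refl N) hj) hf) (y - m)
    rwa [map_mul, Module.End.mul_apply, aeval_X_pow_apply, aeval_X_pow_sub_one_pow,
      Nat.sub_add_cancel hy] at h
  have newton (y : ℕ) (hy : m ≤ y) (n : ℕ) : f (y + n * N) =
      (∑ j ∈ Finset.range k, C ((fwdDiff N)^[j] f y / j.factorial) *
        descPochhammer ℂ j).eval (n : ℂ) := by
    rw [← smul_eq_mul, shift_eq_sum_fwdDiff_iter N f n y, eval_finsetSum]
    have hterm (j : ℕ) : (C ((fwdDiff N)^[j] f y / j.factorial) *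
        descPochhammer ℂ j).eval (n : ℂ) = n.choose j • (fwdDiff N)^[j] f y := by
      rw [eval_mul, eval_C, descPochhammer_eval_eq_descFactorial,
        Nat.descFactorial_eq_factorial_mul_choose, nsmul_eq_mul, Nat.cast_mul]
      have : (j.factorial : ℂ) ≠ 0 := by exact_mod_cast j.factorial_ne_zero
      field_simp
    simp_rw [hterm]
    -- Both sums extend to this common range: binomials vanish for `j > n`, differences for `j ≥ k`.
    trans ∑ j ∈ Finset.range (n + 1 + k), n.choose j • (fwdDiff N)^[j] f y
    · refine Finset.sum_subset (Finset.range_mono (by omega)) fun j _ hj => ?_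
      rw [Nat.choose_eq_zero_of_lt (by simpa using hj), zero_smul]
    · refine (Finset.sum_subset (Finset.range_mono (by omega)) fun j _ hj => ?_).symm
      rw [hΔ j (by simpa using hj) y hy, smul_zero]
  -- The base point `r + m * N` lies in the class of `r` and is at least `m`; the inner polynomial
  -- converts an integer into its number of steps from there.
  let Q (r : Fin N) : ℂ[X] := (∑ j ∈ Finset.range k,
    C ((fwdDiff N)^[j] f (r + m * N) / j.factorial) * descPochhammer ℂ j).comp
      (C (N : ℂ)⁻¹ * (X - C ((r + m * N : ℕ) : ℂ)))
  have hmod (n : ℤ) : (n % N).toNat < N := by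
    have := Int.emod_lt_of_pos n (b := N) (by omega)
    omega
  refine ⟨m * N + N, fun n => (Q ⟨(n % N).toNat, hmod n⟩).eval (n : ℂ), ⟨N, hN, Q, ?_⟩, ?_⟩
  · intro n r hr
    have h : n % N = r := by
      rw [hr, Int.emod_eq_of_lt (by omega) (by exact_mod_cast r.2)]
    have hr : (⟨(n % N).toNat, hmod n⟩ : Fin N) = r := Fin.ext (by simp [h])
    simp only [hr]
  · intro n hn
    have hr : ((n : ℤ) % N).toNat = n % N := by norm_cast
    have hlt := Nat.mod_lt n hN
    obtain ⟨l, hl⟩ : ∃ l, n = (n % N + m * N) + l * N := by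
      refine ⟨n / N - m, ?_⟩
      have h1 := Nat.mod_add_div n N
      have h2 : m ≤ n / N := by
        rw [Nat.le_div_iff_mul_le hN]
        omega
      rw [add_assoc, ← Nat.add_mul, Nat.add_sub_cancel' h2, mul_comm]
      exact h1.symm
    simp only [Q, hr]
    have hN' : (N : ℂ) ≠ 0 := by exact_mod_cast hN.ne'
    have hle : m ≤ n % N + m * N := (Nat.le_mul_of_pos_right m hN).trans (Nat.le_add_left _ _)
    rw [eval_comp]
    have harg : eval (((n : ℤ) : ℂ)) (C (N : ℂ)⁻¹ * (X - C ((n % N + m * N : ℕ) : ℂ))) = l := by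
      have : (n : ℂ) = ((n % N + m * N : ℕ) : ℂ) + l * N := by exact_mod_cast hl
      simp only [eval_mul, eval_C, eval_sub, eval_X, Int.cast_natCast]
      rw [this]
      field_simp
      ring
    rw [harg, ← newton _ hle l, ← hl]

end IsShiftQuasiPolynomial

/-! ### Counting by degree and inclusion-exclusion. -/

/-- The subset `A` has finitely many elements in each degree, and their number is a shift
quasi-polynomial function of the degree. -/
def HasQuasiPolynomialCount {α : Type*} (deg : α → ℕ) (A : Set α) : Prop :=
  (∀ i, (A ∩ deg ⁻¹' {i}).Finite) ∧
    IsShiftQuasiPolynomial fun i => ((A ∩ deg ⁻¹' {i}).ncard : ℂ)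

namespace HasQuasiPolynomialCount

variable {α β ι : Type*} {deg : α → ℕ} {A B : Set α}

theorem empty : HasQuasiPolynomialCount deg (∅ : Set α) :=
  ⟨fun i => by simp, by simpa using! IsShiftQuasiPolynomial.zero⟩

theorem union (hA : HasQuasiPolynomialCount deg A) (hB : HasQuasiPolynomialCount deg B)
    (hAB : HasQuasiPolynomialCount deg (A ∩ B)) : HasQuasiPolynomialCount deg (A ∪ B) := by
  refine ⟨fun i => Set.union_inter_distrib_right A B _ ▸ (hA.1 i).union (hB.1 i), ?_⟩
  convert! (hA.2.add hB.2).sub hAB.2 using 1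
  ext i
  have h := Set.ncard_union_add_ncard_inter _ _ (hA.1 i) (hB.1 i)
  rw [← Set.union_inter_distrib_right, ← Set.inter_inter_distrib_right] at h
  rw [Pi.sub_apply, Pi.add_apply, eq_sub_iff_add_eq]
  exact_mod_cast h

theorem union_of_disjoint (hA : HasQuasiPolynomialCount deg A)
    (hB : HasQuasiPolynomialCount deg B) (h : Disjoint A B) :
    HasQuasiPolynomialCount deg (A ∪ B) :=
  hA.union hB (h.inter_eq ▸ empty)

theorem sdiff (hA : HasQuasiPolynomialCount deg A) (hB : HasQuasiPolynomialCount deg B)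
    (h : B ⊆ A) : HasQuasiPolynomialCount deg (A \ B) := by
  refine ⟨fun i => (hA.1 i).subset (Set.inter_subset_inter_left _ Set.sdiff_subset), ?_⟩
  convert! hA.2.sub hB.2 using 1
  ext i
  have := Set.ncard_sdiff_add_ncard_of_subset (Set.inter_subset_inter_left (deg ⁻¹' {i}) h)
    (hA.1 i)
  rw [← Set.inter_sdiff_distrib_right] at this
  rw [Pi.sub_apply, eq_sub_iff_add_eq]
  exact_mod_cast this

theorem image (hA : HasQuasiPolynomialCount deg A) {deg' : β → ℕ} {f : α → β} (e : ℕ)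
    (hf : Set.InjOn f A) (hdeg : ∀ x ∈ A, deg' (f x) = deg x + e) :
    HasQuasiPolynomialCount deg' (f '' A) := by
  have h (i : ℕ) : f '' A ∩ deg' ⁻¹' {i + e} = f '' (A ∩ deg ⁻¹' {i}) := by
    ext y
    constructor
    · rintro ⟨⟨x, hx, rfl⟩, hy⟩
      have := hdeg x hx
      simp only [Set.mem_preimage, Set.mem_singleton_iff] at hy
      exact ⟨x, ⟨hx, by simp only [Set.mem_preimage, Set.mem_singleton_iff]; omega⟩, rfl⟩
    · rintro ⟨x, ⟨hx, rfl⟩, rfl⟩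
      exact ⟨⟨x, hx, rfl⟩, hdeg x hx⟩
  constructor
  · intro i
    rcases lt_or_ge i e with hi | hi
    · convert Set.finite_empty
      refine Set.eq_empty_of_forall_notMem ?_
      rintro _ ⟨⟨x, hx, rfl⟩, hy⟩
      have := hdeg x hx
      simp only [Set.mem_preimage, Set.mem_singleton_iff] at hy
      omega
    · rw [← Nat.sub_add_cancel hi, h]
      exact (hA.1 _).image f
  · refine .of_shift e ?_
    convert! hA.2 using 3 with i
    rw [h, (hf.mono Set.inter_subset_left).ncard_image]

/-- Inclusion-exclusion: finite unions of members of a family that is closed under intersection. -/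
theorem biUnion_of_inter_closed {C : Set α → Prop} (hC : ∀ A, C A → HasQuasiPolynomialCount deg A)
    (hinter : ∀ A B, C A → C B → C (A ∩ B)) (s : Finset ι) (A : ι → Set α)
    (hA : ∀ i ∈ s, C (A i)) : HasQuasiPolynomialCount deg (⋃ i ∈ s, A i) := by
  classical
  induction s using Finset.induction_on generalizing A with
  | empty => simpa using empty
  | insert a s _ ih =>
    have hs (i : ι) (hi : i ∈ s) : C (A i) := hA i (Finset.mem_insert_of_mem hi)
    have ha : C (A a) := hA a (Finset.mem_insert_self a s)
    rw [Finset.set_biUnion_insert]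
    refine (hC _ ha).union (ih A hs) ?_
    rw [Set.inter_iUnion₂]
    exact ih _ fun i hi => hinter _ _ ha (hs i hi)

theorem iUnion_of_disjoint [Finite ι] {A : ι → Set α}
    (hA : ∀ i, HasQuasiPolynomialCount deg (A i)) (h : Pairwise (Function.onFun Disjoint A)) :
    HasQuasiPolynomialCount deg (⋃ i, A i) := by
  classical
  have := Fintype.ofFinite ι
  suffices ∀ s : Finset ι, HasQuasiPolynomialCount deg (⋃ i ∈ s, A i) by
    simpa using this Finset.univ
  intro s
  induction s using Finset.induction_on with
  | empty => simpa using empty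
  | insert a s ha ih =>
    rw [Finset.set_biUnion_insert]
    refine (hA a).union_of_disjoint ih ?_
    rw [Set.disjoint_iUnion₂_right]
    exact fun i hi => h (ne_of_mem_of_not_mem hi ha).symm

end HasQuasiPolynomialCount

/-! ### Orthants and upper sets in `ℕ^ι` with positive grading. -/

namespace AddMonoidHom

variable {ι : Type*} [DecidableEq ι] (δ : (ι → ℕ) →+ ℕ)

theorem le_apply_of_pos (hδ : ∀ k, 0 < δ (Pi.single k 1)) (c : ι → ℕ) (k : ι) : c k ≤ δ c := by
  have hle : Pi.single k (c k) ≤ c := by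
    intro j
    by_cases h : j = k
    · subst h; simp
    · simp [h]
  obtain ⟨c', hc'⟩ := exists_add_of_le hle
  have h : (Pi.single k (c k) : ι → ℕ) = c k • Pi.single k 1 := by
    rw [← Pi.single_smul]; simp
  calc c k ≤ c k • δ (Pi.single k 1) := Nat.le_mul_of_pos_right _ (hδ k)
    _ = δ (Pi.single k (c k)) := by rw [h, map_nsmul]
    _ ≤ δ (Pi.single k (c k)) + δ c' := Nat.le_add_right _ _
    _ = δ c := by rw [← map_add, ← hc']

variable [Fintype ι]

theorem finite_fiber_of_pos (hδ : ∀ k, 0 < δ (Pi.single k 1)) (i : ℕ) : (δ ⁻¹' {i}).Finite := by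
  refine (Set.finite_Iic (fun _ : ι => i)).subset fun c hc k => ?_
  rw [← (hc : δ c = i)]
  exact δ.le_apply_of_pos hδ c k

/-- With `d` the degree of the basis vector at `a`, a vector of degree `i + d` supported on `insert
a s` either vanishes at `a` or is that basis vector plus one of degree `i`. So the step-`d`
difference of the count is a shift of the count for `s`. -/
theorem hasQuasiPolynomialCount_supportedOn (hδ : ∀ k, 0 < δ (Pi.single k 1)) (s : Finset ι) :
    HasQuasiPolynomialCount δ {c | ∀ k ∉ s, c k = 0} := by
  refine ⟨fun i => (δ.finite_fiber_of_pos hδ i).subset Set.inter_subset_right, ?_⟩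
  induction s using Finset.induction_on with
  | empty =>
    -- Only the zero vector has empty support, and it has degree `0`.
    refine .of_eventually_zero 1 fun i => ?_
    rw [Nat.cast_eq_zero]
    convert Set.ncard_empty (ι → ℕ)
    refine Set.eq_empty_of_forall_notMem ?_
    rintro c ⟨hc, hi⟩
    have : c = 0 := funext fun k => hc k (by simp)
    simp [this] at hi
  | insert a s ha ih =>
    refine .of_fwdDiff (hδ a) ?_
    convert! ih.shift (δ (Pi.single a 1)) using 1
    ext i
    set d := δ (Pi.single a 1) with hd
    rw [fwdDiff, sub_eq_iff_eq_add]
    have hinj : Function.Injective fun c : ι → ℕ => c + Pi.single a 1 := add_left_injective _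
    have hfin (S : Set (ι → ℕ)) (j : ℕ) : (S ∩ δ ⁻¹' {j}).Finite :=
      (δ.finite_fiber_of_pos hδ j).subset Set.inter_subset_right
    rw [← Set.ncard_image_of_injective ({c | ∀ k ∉ insert a s, c k = 0} ∩ δ ⁻¹' {i}) hinj,
      ← Nat.cast_add, Nat.cast_inj, ← Set.ncard_union_eq _ (hfin _ _) ((hfin _ _).image _)]
    · congr 1
      ext c
      simp only [Set.mem_inter_iff, Set.mem_union, Set.mem_image, Set.mem_preimage,
        Set.mem_singleton_iff]
      constructor
      · rintro ⟨hc, hi⟩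
        by_cases h0 : c a = 0
        · refine .inl ⟨fun k hk => ?_, hi⟩
          by_cases hka : k = a
          · rw [hka, h0]
          · exact hc k (by simp [hka, hk])
        · obtain ⟨c', rfl⟩ : ∃ c', c = c' + Pi.single a 1 := by
            refine ⟨c - Pi.single a 1, (tsub_add_cancel_of_le ?_).symm⟩
            intro k
            by_cases h : k = a
            · subst h; simp only [Pi.single_eq_same]; omega
            · simp [h]
          refine .inr ⟨c', ⟨fun k hk => ?_, ?_⟩, rfl⟩
          · have := hc k hk
            simp only [Pi.add_apply] at this
            omega
          · rw [map_add] at hi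
            omega
      · rintro (⟨hc, hi⟩ | ⟨c', ⟨hc, hi⟩, rfl⟩)
        · exact ⟨fun k hk => hc k fun h => hk (Finset.mem_insert_of_mem h), hi⟩
        · refine ⟨fun k hk => ?_, by rw [map_add, hi]⟩
          have hka : k ≠ a := fun h => hk (h ▸ Finset.mem_insert_self a s)
          simp [hc k hk, hka]
    · rw [Set.disjoint_left]
      rintro _ ⟨hc, -⟩ ⟨c', -, rfl⟩
      simpa using hc a ha

theorem hasQuasiPolynomialCount_univ (hδ : ∀ k, 0 < δ (Pi.single k 1)) :
    HasQuasiPolynomialCount δ Set.univ := by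
  simpa using δ.hasQuasiPolynomialCount_supportedOn hδ Finset.univ

theorem hasQuasiPolynomialCount_Ici (hδ : ∀ k, 0 < δ (Pi.single k 1)) (v : ι → ℕ) :
    HasQuasiPolynomialCount δ (Set.Ici v) := by
  convert! (δ.hasQuasiPolynomialCount_univ hδ).image (f := fun c => c + v) (deg' := δ) (δ v)
    (add_left_injective v).injOn fun c _ => map_add δ c v using 1
  ext c
  simp only [Set.mem_Ici, Set.image_univ, Set.mem_range]
  exact ⟨fun h => ⟨c - v, tsub_add_cancel_of_le h⟩, by rintro ⟨c, rfl⟩; exact le_add_self⟩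

end AddMonoidHom

/-- The minimal elements form an antichain, which is finite in a well-quasi-order; for `ℕ^ι` this is
Dickson's lemma. -/
theorem Set.exists_finset_forall_exists_le {α : Type*} [PartialOrder α] [WellQuasiOrderedLE α]
    (S : Set α) : ∃ T : Finset α, ↑T ⊆ S ∧ ∀ x ∈ S, ∃ y ∈ T, y ≤ x := by
  have hS := Set.isPWO_of_wellQuasiOrderedLE S
  have hfin := (setOfPred_minimal_antichain (· ∈ S)).finite_of_partiallyWellOrderedOn
    (hS.mono (setOfPred_minimal_subset _))
  refine ⟨hfin.toFinset, fun x hx => ?_, fun x hx => ?_⟩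
  · exact (hfin.mem_toFinset.1 hx).1
  · obtain ⟨y, hy, hmin⟩ := hS.exists_le_minimal hx
    exact ⟨y, hfin.mem_toFinset.2 hmin, hy⟩

theorem IsUpperSet.hasQuasiPolynomialCount {ι : Type*} [Fintype ι] [DecidableEq ι]
    {S : Set (ι → ℕ)} (hS : IsUpperSet S) (δ : (ι → ℕ) →+ ℕ)
    (hδ : ∀ k, 0 < δ (Pi.single k 1)) : HasQuasiPolynomialCount δ S := by
  obtain ⟨T, hTS, hT⟩ := S.exists_finset_forall_exists_le
  have hST : S = ⋃ v ∈ T, Set.Ici v := by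
    ext c
    simp only [Set.mem_iUnion, Set.mem_Ici, exists_prop]
    exact ⟨fun hc => hT c hc, fun ⟨v, hv, hvc⟩ => hS hvc (hTS hv)⟩
  rw [hST]
  refine .biUnion_of_inter_closed (C := fun A => ∃ v, A = Set.Ici v) ?_ ?_ T _
    fun v _ => ⟨v, rfl⟩
  · rintro _ ⟨v, rfl⟩
    exact δ.hasQuasiPolynomialCount_Ici hδ v
  · rintro _ _ ⟨v, rfl⟩ ⟨w, rfl⟩
    exact ⟨v ⊔ w, Set.Ici_inter_Ici⟩

/-! ### Semilinear sets with finite slices. -/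

section HybridLinearSet

variable {M : Type*} [AddCommMonoid M]

/-- A finite union of translates of a single finitely generated submonoid all of whose nonzero
elements have positive degree. -/
def IsHybridLinearSet (δ : M →+ ℕ) (X : Set M) : Prop :=
  ∃ (F : Finset M) (N : AddSubmonoid M), N.FG ∧ (∀ m ∈ N, δ m = 0 → m = 0) ∧
    X = ⋃ b ∈ F, {x | ∃ m ∈ N, b + m = x}

theorem AddSubmonoid.FG.exists_pos_generators {δ : M →+ ℕ} {N : AddSubmonoid M} (hN : N.FG)
    (hpos : ∀ m ∈ N, δ m = 0 → m = 0) :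
    ∃ (n : ℕ) (g : (Fin n → ℕ) →+ M), AddMonoidHom.mrange g = N ∧
      ∀ k, 0 < δ (g (Pi.single k 1)) := by
  classical
  obtain ⟨t, rfl⟩ := hN
  -- The generator `0` is dropped because it is the only one of degree `0`.
  let e := (t.erase 0).equivFin
  let g : (Fin (t.erase 0).card → ℕ) →+ M :=
    ∑ k, (multiplesHom M (e.symm k : M)).comp (Pi.evalAddMonoidHom (fun _ => ℕ) k)
  have hg (c) : g c = ∑ k, c k • (e.symm k : M) := by simp [g]
  refine ⟨_, g, ?_, fun k => Nat.pos_of_ne_zero fun h => ?_⟩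
  · have ht : AddSubmonoid.closure (t : Set M) =
        AddSubmonoid.closure (Set.range fun k => (e.symm k : M)) := by
      have hr : (Set.range fun k => (e.symm k : M)) = ↑(t.erase 0) := by
        rw [← Function.comp_def, e.symm.surjective.range_comp]
        exact Subtype.range_coe
      rw [hr, Finset.coe_erase, AddSubmonoid.closure_sdiff_singleton_zero]
    ext x
    rw [ht, AddSubmonoid.mem_closure_range_iff_of_fintype, AddMonoidHom.mem_mrange]
    exact exists_congr fun c => by rw [hg, eq_comm]
  · have hk : g (Pi.single k 1) = e.symm k := by
      rw [hg, Finset.sum_eq_single k (fun j _ hj => by simp [hj]) (by simp)]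
      simp
    have hmem := Finset.mem_erase.1 (e.symm k).2
    rw [hk] at h
    exact hmem.1 (hpos _ (AddSubmonoid.subset_closure hmem.2) h)

/-- Choosing the lexicographically smallest coordinates identifies the part of a linear set outside
an invariant set with the complement of an upper set. -/
theorem hasQuasiPolynomialCount_linear_sdiff [IsCancelAdd M] (δ : M →+ ℕ) {n : ℕ}
    (g : (Fin n → ℕ) →+ M) (hg : ∀ k, 0 < δ (g (Pi.single k 1))) (b : M) {X : Set M}
    (hX : ∀ x ∈ X, ∀ c, x + g c ∈ X) :
    HasQuasiPolynomialCount δ ((Set.range fun c => b + g c) \ X) := by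
  let S : Set (Fin n → ℕ) := {c | b + g c ∈ X ∨ ∃ c', toLex c' < toLex c ∧ g c' = g c}
  -- Translation by `w` preserves the lexicographic comparison and the equality of images, and `X`
  -- is stable under adding `g w`.
  have hS : IsUpperSet S := by
    intro c₁ c₂ hle h
    obtain ⟨w, rfl⟩ := exists_add_of_le hle
    rcases h with h | ⟨c', hlt, heq⟩
    · exact .inl (by rw [map_add, ← add_assoc]; exact hX _ h w)
    · exact .inr ⟨c' + w, by simpa only [toLex_add] using add_lt_add_left hlt (toLex w),
        by rw [map_add, map_add, heq]⟩
  have hcount := ((δ.comp g).hasQuasiPolynomialCount_univ hg).sdiff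
    (hS.hasQuasiPolynomialCount (δ.comp g) hg) (Set.subset_univ _)
  convert! hcount.image (f := fun c => b + g c) (deg' := δ) (δ b) ?_ ?_ using 1
  · ext x
    constructor
    · rintro ⟨⟨c, rfl⟩, hx⟩
      obtain ⟨c₀, h₀, hmin⟩ := WellFounded.has_min
        (InvImage.wf (toLex : (Fin n → ℕ) → Lex (Fin n → ℕ)) wellFounded_lt)
        {c' | g c' = g c} ⟨c, rfl⟩
      have h₀ : g c₀ = g c := h₀
      refine ⟨c₀, ⟨trivial, ?_⟩, by simp only [h₀]⟩
      rintro (h | ⟨c', hlt, heq⟩)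
      · exact hx (by simpa only [h₀] using h)
      · exact hmin c' (heq.trans h₀) hlt
    · rintro ⟨c, ⟨-, hc⟩, rfl⟩
      exact ⟨⟨c, rfl⟩, fun h => hc (.inl h)⟩
  · rintro c ⟨-, hc⟩ c' ⟨-, hc'⟩ h
    have h : g c = g c' := add_left_cancel h
    rcases lt_trichotomy (toLex c) (toLex c') with hlt | heq | hlt
    · exact (hc' (.inr ⟨c, hlt, h⟩)).elim
    · exact toLex.injective heq
    · exact (hc (.inr ⟨c', hlt, h.symm⟩)).elim
  · intro c _
    rw [map_add, add_comm]
    rfl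

namespace IsHybridLinearSet

variable [IsCancelAdd M] {δ : M →+ ℕ} {X Y : Set M}

/-- Translates are added one at a time. As all share the same monoid, the union already treated is
stable under it, so the new part is a linear set minus an invariant set. -/
theorem hasQuasiPolynomialCount (hX : IsHybridLinearSet δ X) : HasQuasiPolynomialCount δ X := by
  classical
  obtain ⟨F, N, hN, hpos, rfl⟩ := hX
  obtain ⟨n, g, rfl, hg⟩ := hN.exists_pos_generators hpos
  induction F using Finset.induction_on with
  | empty => simpa using HasQuasiPolynomialCount.empty
  | insert b F hb ih =>
    rw [Finset.set_biUnion_insert, Set.union_comm, ← Set.union_sdiff_self]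
    refine ih.union_of_disjoint ?_ Set.disjoint_sdiff_right
    convert! hasQuasiPolynomialCount_linear_sdiff δ g hg b ?_ using 2
    · ext x
      simp
    · intro x hx c
      simp only [Set.mem_iUnion] at hx ⊢
      obtain ⟨b', hb', m, hm, rfl⟩ := hx
      exact ⟨b', hb', m + g c, add_mem hm ⟨c, rfl⟩, (add_assoc _ _ _).symm⟩

/-- The intersection is the image of the equalizer of two homomorphisms from `ℕ^n₁ × ℕ^n₂`, which is
finitely generated. -/
theorem _root_.AddSubmonoid.FG.inf_of_isCancelAdd {N₁ N₂ : AddSubmonoid M} (h₁ : N₁.FG)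
    (h₂ : N₂.FG) : (N₁ ⊓ N₂).FG := by
  obtain ⟨n₁, g₁, rfl⟩ := AddSubmonoid.fg_iff_exists_fin_addMonoidHom.1 h₁
  obtain ⟨n₂, g₂, rfl⟩ := AddSubmonoid.fg_iff_exists_fin_addMonoidHom.1 h₂
  convert! (AddSubmonoid.fg_eqLocusM (g₁.comp (AddMonoidHom.fst _ _))
    (g₂.comp (AddMonoidHom.snd (Fin n₁ → ℕ) (Fin n₂ → ℕ)))).map
      (g₁.comp (AddMonoidHom.fst _ _)) using 1
  ext x
  constructor
  · rintro ⟨⟨c, rfl⟩, ⟨d, hd⟩⟩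
    exact ⟨(c, d), hd.symm, rfl⟩
  · rintro ⟨⟨c, d⟩, hcd, rfl⟩
    exact ⟨⟨c, rfl⟩, ⟨d, (show g₁ c = g₂ d from hcd).symm⟩⟩

/-- The equation `b₁ + g₁ c = b₂ + g₂ d` has finitely many minimal solutions; by cancellation, every
solution is a minimal one plus a solution of `g₁ c = g₂ d`. -/
theorem _root_.AddSubmonoid.FG.exists_inter_translates {N₁ N₂ : AddSubmonoid M} (h₁ : N₁.FG)
    (h₂ : N₂.FG) (b₁ b₂ : M) : ∃ F : Finset M,
      {x | ∃ m ∈ N₁, b₁ + m = x} ∩ {x | ∃ m ∈ N₂, b₂ + m = x} =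
        ⋃ b ∈ F, {x | ∃ m ∈ N₁ ⊓ N₂, b + m = x} := by
  classical
  obtain ⟨n₁, g₁, rfl⟩ := AddSubmonoid.fg_iff_exists_fin_addMonoidHom.1 h₁
  obtain ⟨n₂, g₂, rfl⟩ := AddSubmonoid.fg_iff_exists_fin_addMonoidHom.1 h₂
  obtain ⟨T, hT, hmin⟩ := Set.exists_finset_forall_exists_le
    {z : (Fin n₁ → ℕ) × (Fin n₂ → ℕ) | b₁ + g₁ z.1 = b₂ + g₂ z.2}
  refine ⟨T.image fun z => b₁ + g₁ z.1, ?_⟩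
  ext x
  simp only [Set.mem_iUnion]
  constructor
  · rintro ⟨⟨_, ⟨c, rfl⟩, rfl⟩, ⟨_, ⟨d, rfl⟩, hd⟩⟩
    obtain ⟨z, hz, hle⟩ := hmin (c, d) hd.symm
    have hz' : b₁ + g₁ z.1 = b₂ + g₂ z.2 := hT hz
    obtain ⟨⟨c', d'⟩, h⟩ := exists_add_of_le hle
    obtain ⟨rfl, rfl⟩ := Prod.mk.inj h
    simp only [map_add, ← add_assoc, hz'] at hd
    exact ⟨_, Finset.mem_image_of_mem _ hz, g₁ c',
      ⟨⟨c', rfl⟩, ⟨d', add_left_cancel hd⟩⟩, by simp only [map_add, add_assoc]⟩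
  · rintro ⟨_, hb, m, ⟨⟨c, hc⟩, ⟨d, hd⟩⟩, rfl⟩
    obtain ⟨z, hz, rfl⟩ := Finset.mem_image.1 hb
    have hz' : b₁ + g₁ z.1 = b₂ + g₂ z.2 := hT hz
    refine ⟨⟨_, ⟨z.1 + c, rfl⟩, ?_⟩, ⟨_, ⟨z.2 + d, rfl⟩, ?_⟩⟩
    · rw [map_add, hc, add_assoc]
    · rw [map_add, hd, hz', add_assoc]

theorem inter (hX : IsHybridLinearSet δ X) (hY : IsHybridLinearSet δ Y) :
    IsHybridLinearSet δ (X ∩ Y) := by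
  classical
  obtain ⟨F₁, N₁, h₁, hpos, rfl⟩ := hX
  obtain ⟨F₂, N₂, h₂, -, rfl⟩ := hY
  choose F hF using h₁.exists_inter_translates h₂
  refine ⟨F₁.biUnion fun b₁ => F₂.biUnion fun b₂ => F b₁ b₂, N₁ ⊓ N₂, h₁.inf_of_isCancelAdd h₂,
    fun m hm => hpos m hm.1, ?_⟩
  simp only [Finset.set_biUnion_biUnion, ← hF, Set.iUnion₂_inter]
  simp only [Set.inter_iUnion₂]

end IsHybridLinearSet

/-- A period `x` of degree `0` would put all `a + k • x` in one slice, and independence of the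
periods makes them distinct. -/
theorem IsProperLinearSet.isHybridLinearSet {δ : M →+ ℕ} [IsCancelAdd M] {X : Set M}
    (hX : IsProperLinearSet X) (hfin : ∀ i, (X ∩ δ ⁻¹' {i}).Finite) : IsHybridLinearSet δ X := by
  obtain ⟨a, t, ht, hind, rfl⟩ := hX
  have hpos (x : M) (hx : x ∈ t) : δ x ≠ 0 := by
    intro h0
    refine Set.infinite_of_injective_forall_mem (f := fun k : ℕ => a + k • x) ?_ ?_ (hfin (δ a))
    · intro k l hkl
      have hkl : k • x = l • x := add_left_cancel hkl
      have h := hind.linearIndependent (R := ℕ) (a₁ := Finsupp.single ⟨x, hx⟩ k)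
        (a₂ := Finsupp.single ⟨x, hx⟩ l) (by simpa using hkl)
      exact Finsupp.single_injective _ h
    · intro k
      refine ⟨⟨k • x, AddSubmonoid.nsmul_mem _ (AddSubmonoid.subset_closure hx) k, rfl⟩, ?_⟩
      simp [h0]
  refine ⟨{a}, AddSubmonoid.closure t, (AddSubmonoid.fg_iff _).2 ⟨t, rfl, ht⟩, fun m hm => ?_, ?_⟩
  · induction hm using AddSubmonoid.closure_induction with
    | mem x hx => exact fun h => (hpos x hx h).elim
    | zero => exact fun _ => rfl
    | add x y _ _ ihx ihy =>
      intro h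
      rw [map_add, Nat.add_eq_zero_iff] at h
      rw [ihx h.1, ihy h.2, add_zero]
  · ext x
    simp [Set.mem_vadd_set]

/-- A semilinear set with finitely many elements in each degree has a quasi-polynomial count. -/
theorem IsSemilinearSet.hasQuasiPolynomialCount [IsCancelAdd M] {δ : M →+ ℕ} {X : Set M}
    (hX : IsSemilinearSet X) (hfin : ∀ i, (X ∩ δ ⁻¹' {i}).Finite) :
    HasQuasiPolynomialCount δ X := by
  obtain ⟨S, hS, rfl⟩ := isProperSemilinearSet_iff.1 hX.isProperSemilinearSet
  rw [Set.sUnion_eq_biUnion]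
  -- Unlike proper linear sets, hybrid linear sets are closed under intersection, as
  -- inclusion-exclusion requires.
  refine HasQuasiPolynomialCount.biUnion_of_inter_closed (C := IsHybridLinearSet δ)
    (fun _ => IsHybridLinearSet.hasQuasiPolynomialCount) (fun _ _ => IsHybridLinearSet.inter)
    S _ fun X hXS => (hS X hXS).isHybridLinearSet fun i => (hfin i).subset ?_
  exact Set.inter_subset_inter_left _ (Set.subset_sUnion_of_mem hXS)

end HybridLinearSet

/-! ### Kleene's theorem for commutative labels. -/

/-- The sums of labels along the nonempty walks from one vertex to another whose interior vertices
lie in `S`, where the edges from `q` to `q'` are labelled by the elements of `A q q'`. -/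
inductive IsWalkLabel {Q M : Type*} [Add M] (A : Q → Q → Set M) (S : Set Q) : Q → Q → M → Prop
  | single {q q' : Q} {a : M} (ha : a ∈ A q q') : IsWalkLabel A S q q' a
  | cons {q r q' : Q} {a m : M} (ha : a ∈ A q r) (hr : r ∈ S) (hm : IsWalkLabel A S r q' m) :
      IsWalkLabel A S q q' (a + m)

namespace IsWalkLabel

open scoped Pointwise

variable {Q M : Type*} [AddCommMonoid M] {A : Q → Q → Set M} {S T : Set Q} {q r q' : Q} {m m' : M}

theorem mono (hST : S ⊆ T) (h : IsWalkLabel A S q q' m) : IsWalkLabel A T q q' m := by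
  induction h with
  | single ha => exact .single ha
  | cons ha hr _ ih => exact .cons ha (hST hr) ih

theorem trans (hr : r ∈ S) (h : IsWalkLabel A S q r m) (h' : IsWalkLabel A S r q' m') :
    IsWalkLabel A S q q' (m + m') := by
  induction h with
  | single ha => exact .cons ha hr h'
  | cons ha hs _ ih => exact add_assoc (_ : M) _ _ ▸ .cons ha hs (ih hr h')

theorem add_closure (hr : r ∈ S) (h : IsWalkLabel A S q r m)
    (h' : m' ∈ AddSubmonoid.closure {x | IsWalkLabel A S r r x}) :
    IsWalkLabel A S q r (m + m') := by
  induction h' using AddSubmonoid.closure_induction generalizing m with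
  | mem x hx => exact h.trans hr hx
  | zero => rwa [add_zero]
  | add x y _ _ ihx ihy => exact add_assoc m x y ▸ ihy (ihx h)

/-- Cut a walk at its visits to `r`: either there are none, or it is a first arrival, some loops at
`r`, and a last departure. -/
theorem setOf_insert (A : Q → Q → Set M) (S : Set Q) (r q q' : Q) :
    {m | IsWalkLabel A (insert r S) q q' m} = {m | IsWalkLabel A S q q' m} ∪
      ({m | IsWalkLabel A S q r m} + (AddSubmonoid.closure {m | IsWalkLabel A S r r m} : Set M) +
        {m | IsWalkLabel A S r q' m}) := by
  have hS : S ⊆ insert r S := Set.subset_insert r S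
  have hr : r ∈ insert r S := Set.mem_insert r S
  ext m
  constructor
  · intro h
    replace h : IsWalkLabel A (insert r S) q q' m := h
    induction h with
    | single ha => exact .inl (.single ha)
    | @cons q s q' a m ha hs _ ih =>
      rcases hs with rfl | hs
      · refine .inr ?_
        rcases ih with ih | ⟨_, ⟨x, hx, y, hy, rfl⟩, z, hz, rfl⟩
        · exact ⟨a + 0, ⟨a, .single ha, 0, zero_mem _, rfl⟩, m, ih, by rw [add_zero]⟩
        · exact ⟨a + (x + y), ⟨a, .single ha, x + y,
            -- The walk now starts at `r`, so its former arrival part `x` becomes one more loop.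
            add_mem (AddSubmonoid.subset_closure hx) hy, rfl⟩, z, hz, add_assoc _ _ _⟩
      · rcases ih with ih | ⟨_, ⟨x, hx, y, hy, rfl⟩, z, hz, rfl⟩
        · exact .inl (.cons ha hs ih)
        · exact .inr ⟨a + x + y, ⟨a + x, .cons ha hs hx, y, hy, rfl⟩, z, hz,
            by simp only [add_assoc]⟩
  · rintro (h | ⟨_, ⟨x, hx, y, hy, rfl⟩, z, hz, rfl⟩)
    · exact IsWalkLabel.mono hS h
    · refine .trans hr (.add_closure hr (.mono hS hx) ?_) (.mono hS hz)
      exact AddSubmonoid.closure_mono (fun m hm => IsWalkLabel.mono hS hm) hy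

/-- Kleene's theorem in a commutative monoid. -/
theorem isSemilinearSet [Finite Q] (hA : ∀ q q', IsSemilinearSet (A q q')) (q q' : Q) :
    IsSemilinearSet {m | IsWalkLabel A Set.univ q q' m} := by
  induction Set.univ, Set.finite_univ (α := Q) using Set.Finite.induction_on generalizing q q' with
  | empty =>
    convert! hA q q' using 1
    ext m
    refine ⟨fun h => ?_, fun h => .single h⟩
    cases h with
    | single ha => exact ha
    | cons _ hr _ => exact hr.elim
  | insert _ _ ih =>
    rw [setOf_insert]
    exact (ih q q').union (((ih _ _).add (ih _ _).closure).add (ih _ _))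

end IsWalkLabel

/-! ### Walks and balls in periodic graphs. -/

namespace WeightedDigraph

open scoped Pointwise

variable {V E L : Type*} {Γ : WeightedDigraph V E}

theorem dist_le_coe_iff {x y : V} {i : ℕ} :
    Γ.dist x y ≤ i ↔ ∃ p, Γ.IsWalk x y p ∧ Γ.walkWeight p ≤ i := by
  -- As a strict bound `< i + 1`, the inequality on the infimum yields an actual walk.
  rw [← ENat.lt_add_one_iff (ENat.natCast_ne_top i), dist]
  simp only [iInf_lt_iff, exists_prop]
  refine exists_congr fun p => and_congr_right fun _ => ?_
  rw [ENat.lt_add_one_iff (ENat.natCast_ne_top i), Nat.cast_le]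

theorem mem_ballAround_iff {U : Finset V} {i : ℕ} {y : V} :
    y ∈ Γ.ballAround U i ↔ ∃ x ∈ U, ∃ p, Γ.IsWalk x y p ∧ Γ.walkWeight p ≤ i := by
  change (⨅ x ∈ U, Γ.dist x y) ≤ (i : ℕ∞) ↔ _
  rw [← ENat.lt_add_one_iff (ENat.natCast_ne_top i)]
  simp only [iInf_lt_iff, exists_prop]
  refine exists_congr fun x => and_congr_right fun _ => ?_
  rw [ENat.lt_add_one_iff (ENat.natCast_ne_top i), dist_le_coe_iff]

@[simp]
theorem walkWeight_nil : Γ.walkWeight [] = 0 := rfl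

@[simp]
theorem walkWeight_cons (e : E) (p : List E) :
    Γ.walkWeight (e :: p) = Γ.weight e + Γ.walkWeight p := by
  simp [walkWeight]

/-- Weights are positive, so the first edge strictly lowers the remaining budget. -/
theorem finite_reachable (hout : ∀ x, {e | Γ.src e = x}.Finite) (x : V) (i : ℕ) :
    {y | ∃ p, Γ.IsWalk x y p ∧ Γ.walkWeight p ≤ i}.Finite := by
  induction i generalizing x with
  | zero =>
    refine (Set.finite_singleton x).subset ?_
    rintro y ⟨_ | ⟨e, p⟩, hp, hw⟩
    · exact hp.symm
    · have := Γ.weight_pos e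
      rw [walkWeight_cons] at hw
      omega
  | succ i ih =>
    refine ((Set.finite_singleton x).union
      ((hout x).biUnion fun e _ => ih (Γ.tgt e))).subset ?_
    rintro y ⟨_ | ⟨e, p⟩, hp, hw⟩
    · exact .inl hp.symm
    · have := Γ.weight_pos e
      rw [walkWeight_cons] at hw
      exact .inr (Set.mem_biUnion hp.1 ⟨p, hp.2, by omega⟩)

theorem finite_ballAround (hout : ∀ x, {e | Γ.src e = x}.Finite) (U : Finset V) (i : ℕ) :
    (Γ.ballAround U i).Finite := by
  refine (U.finite_toSet.biUnion fun x _ => finite_reachable hout x i).subset fun y hy => ?_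
  obtain ⟨x, hx, h⟩ := mem_ballAround_iff.1 hy
  exact Set.mem_biUnion hx h

variable [AddCommGroup L] [AddAction L V] [AddAction L E] {n : ℕ}

namespace IsPeriodic

theorem vadd_right_injective (hΓ : Γ.IsPeriodic L n) (x : V) :
    Function.Injective fun u : L => u +ᵥ x := by
  intro u u' h
  have h : u +ᵥ x = u' +ᵥ x := h
  refine (sub_eq_zero.1 (hΓ.free_vertices (u - u') x ?_))
  rw [sub_eq_neg_add, add_vadd, h, neg_vadd_vadd]

/-- Two edges of one orbit with the same source coincide by freeness on vertices, so the outgoing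
edges inject into the finite edge quotient. -/
theorem finite_out (hΓ : Γ.IsPeriodic L n) (x : V) : {e | Γ.src e = x}.Finite := by
  have := hΓ.finite_edges
  refine Set.Finite.of_finite_image
    (f := fun e => (Quotient.mk'' e : AddAction.orbitRel.Quotient L E)) (Set.toFinite _) ?_
  intro e he e' he' h
  obtain ⟨u, rfl⟩ : ∃ u : L, u +ᵥ e' = e := AddAction.orbitRel_apply.1 (Quotient.exact h)
  have hs : u +ᵥ Γ.src e' = Γ.src e' := by
    rw [← hΓ.src_vadd]
    exact Eq.trans he (Eq.symm he')
  rw [hΓ.free_vertices u _ hs, zero_vadd]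

theorem isWalk_map_vadd (hΓ : Γ.IsPeriodic L n) (u : L) {x y : V} {p : List E}
    (h : Γ.IsWalk x y p) : Γ.IsWalk (u +ᵥ x) (u +ᵥ y) (p.map (u +ᵥ ·)) := by
  induction p generalizing x with
  | nil => exact congrArg _ h
  | cons e p ih =>
    refine ⟨by rw [hΓ.src_vadd, h.1], ?_⟩
    rw [hΓ.tgt_vadd]
    exact ih h.2

theorem walkWeight_map_vadd (hΓ : Γ.IsPeriodic L n) (u : L) (p : List E) :
    Γ.walkWeight (p.map (u +ᵥ ·)) = Γ.walkWeight p := by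
  simp [walkWeight, Function.comp_def, hΓ.weight_vadd]

end IsPeriodic

theorem exists_vadd_out (L : Type*) [AddCommGroup L] [AddAction L V] (y : V) :
    ∃ (q : AddAction.orbitRel.Quotient L V) (u : L), u +ᵥ q.out = y := by
  refine ⟨Quotient.mk'' y, ?_⟩
  exact AddAction.orbitRel_apply.1
    ((AddAction.orbitRel L V).symm (Quotient.mk_out (s := AddAction.orbitRel L V) y))

/-- The displacements and weights of the edges between the orbits `q` and `q'`, relative to the
chosen representatives of the orbits. -/
def edgeLabels (Γ : WeightedDigraph V E) (L : Type*) [AddCommGroup L] [AddAction L V]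
    (q q' : AddAction.orbitRel.Quotient L V) : Set (L × ℕ) :=
  {m | ∃ e, Γ.src e = q.out ∧ Γ.tgt e = m.1 +ᵥ q'.out ∧ Γ.weight e = m.2}

/-- The displacements and weights of the walks between the orbits `q` and `q'`, relative to the
chosen representatives of the orbits. -/
def walkLabels (Γ : WeightedDigraph V E) (L : Type*) [AddCommGroup L] [AddAction L V]
    (q q' : AddAction.orbitRel.Quotient L V) : Set (L × ℕ) :=
  {m | ∃ p, Γ.IsWalk q.out (m.1 +ᵥ q'.out) p ∧ Γ.walkWeight p = m.2}

namespace IsPeriodic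

theorem finite_edgeLabels (hΓ : Γ.IsPeriodic L n) (q q' : AddAction.orbitRel.Quotient L V) :
    (Γ.edgeLabels L q q').Finite := by
  have h (e : E) : {m : L × ℕ | Γ.tgt e = m.1 +ᵥ q'.out ∧ Γ.weight e = m.2}.Finite := by
    refine Set.Subsingleton.finite ?_
    rintro ⟨u, w⟩ ⟨h₁, h₂⟩ ⟨u', w'⟩ ⟨h₁', h₂'⟩
    exact Prod.ext (hΓ.vadd_right_injective _ (h₁.symm.trans h₁')) (h₂.symm.trans h₂')
  refine ((hΓ.finite_out q.out).biUnion fun e _ => h e).subset ?_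
  rintro m ⟨e, he, h⟩
  exact Set.mem_biUnion he h

theorem exists_isWalk_of_isWalkLabel (hΓ : Γ.IsPeriodic L n)
    {q q' : AddAction.orbitRel.Quotient L V} {m : L × ℕ}
    (h : IsWalkLabel (Γ.edgeLabels L) Set.univ q q' m) : m ∈ Γ.walkLabels L q q' := by
  induction h with
  | single ha =>
    obtain ⟨e, hs, ht, hw⟩ := ha
    exact ⟨[e], ⟨hs, ht⟩, by simpa using hw⟩
  | @cons q r q' a m ha _ _ ih =>
    obtain ⟨e, hs, ht, hw⟩ := ha
    obtain ⟨p, hp, hpw⟩ := ih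
    refine ⟨e :: p.map (a.1 +ᵥ ·), ⟨hs, ?_⟩, ?_⟩
    · rw [ht, Prod.fst_add, add_vadd]
      exact hΓ.isWalk_map_vadd a.1 hp
    · rw [walkWeight_cons, hΓ.walkWeight_map_vadd, hw, hpw, Prod.snd_add]

/-- The start is an arbitrary translate so that the induction applies to the tail of the walk. Empty
walks have no `IsWalkLabel` and are treated separately. -/
theorem isWalkLabel_of_isWalk (hΓ : Γ.IsPeriodic L n) {q q' : AddAction.orbitRel.Quotient L V}
    {u u' : L} {e : E} {p : List E} (h : Γ.IsWalk (u +ᵥ q.out) (u' +ᵥ q'.out) (e :: p)) :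
    IsWalkLabel (Γ.edgeLabels L) Set.univ q q' (-u + u', Γ.walkWeight (e :: p)) := by
  have hedge {q r : AddAction.orbitRel.Quotient L V} {u v : L} {e : E}
      (hs : Γ.src e = u +ᵥ q.out) (ht : Γ.tgt e = v +ᵥ r.out) :
      (-u + v, Γ.weight e) ∈ Γ.edgeLabels L q r :=
    ⟨-u +ᵥ e, by rw [hΓ.src_vadd, hs, neg_vadd_vadd], by rw [hΓ.tgt_vadd, ht, add_vadd],
      hΓ.weight_vadd _ _⟩
  induction p generalizing q u e with
  | nil => exact .single (by simpa using hedge h.1 h.2)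
  | cons e' p ih =>
    obtain ⟨r, v, hr⟩ := exists_vadd_out L (Γ.tgt e)
    convert! IsWalkLabel.cons (hedge h.1 hr.symm) (Set.mem_univ r) (ih (hr ▸ h.2)) using 1
    ext <;> simp

theorem isSemilinearSet_walkLabels (hΓ : Γ.IsPeriodic L n)
    (q q' : AddAction.orbitRel.Quotient L V) : IsSemilinearSet (Γ.walkLabels L q q') := by
  have := hΓ.finite_vertices
  have htrivial : {m : L × ℕ | q.out = m.1 +ᵥ q'.out ∧ 0 = m.2}.Finite := by
    refine Set.Subsingleton.finite ?_
    rintro ⟨u, w⟩ ⟨h₁, h₂⟩ ⟨u', w'⟩ ⟨h₁', h₂'⟩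
    exact Prod.ext (hΓ.vadd_right_injective _ (h₁.symm.trans h₁')) (h₂.symm.trans h₂')
  convert! (IsWalkLabel.isSemilinearSet (A := Γ.edgeLabels L)
    (fun q q' => .of_finite (hΓ.finite_edgeLabels q q')) q q').union (.of_finite htrivial) using 1
  ext ⟨u, w⟩
  constructor
  · rintro ⟨_ | ⟨e, p⟩, hp, hw⟩
    · exact .inr ⟨hp, hw⟩
    · refine .inl ?_
      rw [← show _ = w from hw]
      rw [← zero_vadd L q.out] at hp
      simpa using hΓ.isWalkLabel_of_isWalk hp
  · rintro (h | h)
    · exact hΓ.exists_isWalk_of_isWalkLabel h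
    · exact ⟨[], h⟩

theorem isSemilinearSet_ballAround (hΓ : Γ.IsPeriodic L n) (U : Finset V)
    (q : AddAction.orbitRel.Quotient L V) :
    IsSemilinearSet {m : L × ℕ | m.1 +ᵥ q.out ∈ Γ.ballAround U m.2} := by
  choose r v hrv using exists_vadd_out (V := V) L
  -- Translation by `v x` moves the start from the representative to `x`; multiples of `(0, 1)`
  -- supply the slack between the walk's weight and the radius.
  convert! IsSemilinearSet.biUnion_finset (s := U)
    (t := fun x => (v x, 0) +ᵥ (Γ.walkLabels L (r x) q +
      (AddSubmonoid.closure {((0 : L), 1)} : Set (L × ℕ)))) fun x _ =>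
    ((hΓ.isSemilinearSet_walkLabels (r x) q).add
      (.closure_of_finite (Set.finite_singleton _))).vadd _ using 1
  ext ⟨u, i⟩
  simp only [Set.mem_iUnion]
  change u +ᵥ q.out ∈ Γ.ballAround U i ↔ _
  rw [mem_ballAround_iff]
  refine exists_congr fun x => ?_
  rw [exists_prop]
  refine and_congr_right fun _ => ?_
  constructor
  · rintro ⟨p, hp, hw⟩
    have h := hΓ.isWalk_map_vadd (-v x) hp
    rw [← add_vadd, show -v x +ᵥ x = (r x).out by rw [neg_vadd_eq_iff, hrv]] at h
    refine ⟨_, ⟨(-v x + u, Γ.walkWeight p), ⟨_, h, hΓ.walkWeight_map_vadd _ _⟩,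
      (0, i - Γ.walkWeight p), AddSubmonoid.mem_closure_singleton.2 ⟨i - Γ.walkWeight p, ?_⟩, rfl⟩,
      ?_⟩
    · ext <;> simp
    · ext
      · simp
      · simp [hw]
  · rintro ⟨_, ⟨⟨u', w⟩, ⟨p, hp, hw⟩, s, hs, rfl⟩, heq⟩
    obtain ⟨k, rfl⟩ := AddSubmonoid.mem_closure_singleton.1 hs
    have hu : v x + u' = u := by simpa using congrArg Prod.fst heq
    have hi : w + k = i := by simpa using congrArg Prod.snd heq
    refine ⟨p.map (v x +ᵥ ·), ?_, ?_⟩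
    · have h := hΓ.isWalk_map_vadd (v x) hp
      rwa [hrv, ← add_vadd, hu] at h
    · rw [hΓ.walkWeight_map_vadd, show Γ.walkWeight p = w from hw]
      omega

/-- All balls are stacked into one set graded by the radius and split by vertex orbit; freeness
identifies each piece with a semilinear subset of `L × ℕ`. -/
theorem hasQuasiPolynomialCount_ballAround (hΓ : Γ.IsPeriodic L n) (U : Finset V) :
    HasQuasiPolynomialCount (Prod.snd : V × ℕ → ℕ) {z | z.1 ∈ Γ.ballAround U z.2} := by
  have := hΓ.finite_vertices
  let B (q : AddAction.orbitRel.Quotient L V) : Set (V × ℕ) :=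
    (fun m : L × ℕ => (m.1 +ᵥ q.out, m.2)) '' {m | m.1 +ᵥ q.out ∈ Γ.ballAround U m.2}
  have hinj (q : AddAction.orbitRel.Quotient L V) :
      Function.Injective fun m : L × ℕ => (m.1 +ᵥ q.out, m.2) := by
    rintro ⟨u, i⟩ ⟨u', i'⟩ h
    obtain ⟨h₁, h₂⟩ := Prod.mk.inj h
    exact Prod.ext (hΓ.vadd_right_injective _ h₁) h₂
  have hB : {z : V × ℕ | z.1 ∈ Γ.ballAround U z.2} = ⋃ q, B q := by
    ext ⟨y, i⟩
    simp only [Set.mem_iUnion]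
    constructor
    · intro h
      obtain ⟨q, u, rfl⟩ := exists_vadd_out L y
      exact ⟨q, (u, i), h, rfl⟩
    · rintro ⟨q, ⟨u, j⟩, h, heq⟩
      obtain ⟨rfl, rfl⟩ := Prod.mk.inj heq
      exact h
  rw [hB]
  refine .iUnion_of_disjoint (fun q => ?_) fun q q' hne => ?_
  · refine ((hΓ.isSemilinearSet_ballAround U q).hasQuasiPolynomialCount
      (δ := AddMonoidHom.snd L ℕ) fun i => ?_).image 0 (hinj q).injOn fun _ _ => rfl
    refine Set.Finite.of_finite_image (f := fun m : L × ℕ => (m.1 +ᵥ q.out, m.2)) ?_ (hinj q).injOn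
    refine ((finite_ballAround hΓ.finite_out U i).prod (Set.finite_singleton i)).subset ?_
    rintro _ ⟨⟨u, j⟩, ⟨h, hj⟩, rfl⟩
    obtain rfl : j = i := hj
    exact ⟨h, rfl⟩
  · refine Set.disjoint_left.2 ?_
    rintro _ ⟨m, -, rfl⟩ ⟨m', -, h⟩
    refine hne ?_
    have h : m'.1 +ᵥ q'.out = m.1 +ᵥ q.out := congrArg Prod.fst h
    rw [← q.out_eq', ← q'.out_eq']
    refine Quotient.sound ?_
    refine AddAction.orbitRel_apply.2 ⟨-m.1 + m'.1, ?_⟩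
    change (-m.1 + m'.1) +ᵥ q'.out = q.out
    rw [add_vadd, h, neg_vadd_vadd]

end IsPeriodic

end WeightedDigraph

theorem theoremA5 {V E L : Type*} [AddCommGroup L] [AddAction L V] [AddAction L E]
    (Γ : WeightedDigraph V E) (n : ℕ) (hΓ : Γ.IsPeriodic L n) (U : Finset V) :
    (∀ i : ℕ, (Γ.ballAround U i).Finite) ∧
      IsQuasiPolynomialType (fun i : ℕ => ((Γ.ballAround U i).ncard : ℂ)) := by
  refine ⟨WeightedDigraph.finite_ballAround hΓ.finite_out U, ?_⟩
  convert! (hΓ.hasQuasiPolynomialCount_ballAround U).2.isQuasiPolynomialType using 3 with i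
  rw [← Set.ncard_image_of_injective (Γ.ballAround U i) (Prod.mk_left_injective i)]
  congr 1
  ext ⟨y, j⟩
  constructor
  · rintro ⟨y, hy, heq⟩
    obtain ⟨rfl, rfl⟩ := Prod.mk.inj heq
    exact ⟨hy, rfl⟩
  · rintro ⟨hy, hj⟩
    obtain rfl : j = i := hj
    exact ⟨y, hy, rfl⟩
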